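/- **Proposition 2.** Let $m_1,m_2,n$ be positive integers, $\ell\in\mathbb Z$, $\alpha=m_1-m_2$, and let $\hat Q_3(m_1,-m_2,n,\ell)$ be the closure of the 3-braid $\beta=(\sigma_1^{m_1}\sigma_2^{-m_2})^n(\sigma_1\sigma_2)^{3\ell}$. Write $[k]_q=\frac{q^k-q^{-k}}{q-q^{-1}}$ and $[N+k]_q=\frac{Aq^k-A^{-1}q^{-k}}{q-q^{-1}}$ (so $A=q^N$), and $$S^*_{[1]}=[N]_q,\quad S^*_{[3,0,0]}=\tfrac{[N]_q[N+1]_q[N+2]_q}{[2]_q[3]_q},\quad S^*_{[1,1,1]}=\tfrac{[N]_q[N-1]_q[N-2]_q}{[2]_q[3]_q},\quad S^*_{[2,1,0]}=\tfrac{[N]_q[N+1]_q[N-1]_q}{[3]_q}.$$ The normalized HOMFLY-PT polynomial of the closure of a 3-braid is $\mathcal H_{[1]}=\frac1{S^*_{[1]}}\sum_{\Xi}S^*_\Xi\,\mathrm{Tr}_\Xi$, where $\Xi$ runs over $[3,0,0],[1,1,1],[2,1,0]$ and $\mathrm{Tr}_\Xi$ is the trace of the image of the braid under $\sigma_i\mapsto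 \mathfrak R_i^{\Xi}$, with $\mathfrak R_1^{[3,0,0]}=\mathfrak R_2^{[3,0,0]}=\frac qA$, $\mathfrak R_1^{[1,1,1]}=\mathfrak R_2^{[1,1,1]}=-\frac1{qA}$, $\mathfrak R^{[2,1,0]}_1=\frac1A\begin{pmatrix}q&0\\0&-q^{-1}\end{pmatrix}$ and $\mathfrak R^{[2,1,0]}_2=U\mathfrak R^{[2,1,0]}_1U^{-1}$, $U=\frac1{[2]_q}\begin{pmatrix}1&\sqrt{[3]_q}\\-\sqrt{[3]_q}&1\end{pmatrix}$. Then, for all complex $q,A$ with $q,A\neq0$, $q^4\ne1$, $q^6\neq1$, $A^2\neq1$, $$\mathcal H_{[1]}^{\hat Q_3(m_1,-m_2,n,\ell)}=\frac1{S^*_{[1]}}\Big(\big(\tfrac qA\big)^{n\alpha+6\ell}S^*_{[3,0,0]}+(-qA)^{-n\alpha-6\ell}S^*_{[1,1,1]}+\big(\tfrac1A\big)^{n\alpha+6\ell}S^*_{[2,1,0]}\,\Omega\Big),$$ $$\Omega=\sum_{j=0}^{\lfloor n/2\rfloor}\sum_{k=1}^{n-j}(-1)^{-n\alpha/2}\binom{k+j-2}{j-1}\binom{n-(k+j-1)}{j}G_{j,k},$$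 $$G_{j,k}=\sum_{k_1=0}^{n+1-2j-k}\sum_{k_2=0}^{k-1}\sum_{k_3=0}^{2j}\sum_{\ell_1=1}^{2}\binom{n-(k+2j-1)}{k_1}\binom{2j}{k_3}\binom{k-1}{k_2}\frac{[3]_q^{\,j+k_1+k_2}}{[2]_q^{\,2n}}(-1)^{\mu(\ell_1)\left(\alpha(k-1-\frac n2)+m_2(k_2-k_1)\right)+k_3(m_2+1)-m_1j}\,q^{\mu(\ell_1)\left(\alpha(-2+2j+2k-n)+2m_2(k_2-k_1)\right)+2m_2(k_3-j)}.$$ Here $\mu$ is the Möbius function, $(-1)^x=e^{i\pi x}$, a sum whose upper limit is less than its lower limit is $0$, and for $j=0$ the coefficient $\binom{k-2}{-1}$ is $1$ if $k=1$ and $0$ if $k\ge2$. Moreover, if $A=q^N$ for some $N\in\mathbb N$, the same expression is the Reshetikhin–Turaev invariant of the closure of $\beta$ in the vector representation $V=\mathbb C^N$ of $U_q(\mathfrak{sl}_N)$, that is, $\frac1{[N]_q}\mathrm{Tr}_{V^{\otimes 3}}\big(K^{\otimes3}\pi(\beta)\big)$, where $\pi(\sigma_i)$ is $q^{-N}$ times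 the standard braiding (with eigenvalues $q,-q^{-1}$) on the factors $i,i+1$ and $K=\mathrm{diag}(q^{1-N},q^{3-N},\dots,q^{N-1})$. -/

import Mathlib

/-! ### The braid group on three strands -/

/-- The single Artin relator `σ₁σ₂σ₁(σ₂σ₁σ₂)⁻¹`. -/
def artinRels : Set (FreeGroup (Fin 2)) :=
  {FreeGroup.of 0 * FreeGroup.of 1 * FreeGroup.of 0 *
    (FreeGroup.of 1 * FreeGroup.of 0 * FreeGroup.of 1)⁻¹}

/-- The braid group `B₃ = ⟨σ₁, σ₂ ∣ σ₁σ₂σ₁ = σ₂σ₁σ₂⟩`. -/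
abbrev B3 : Type := PresentedGroup artinRels

/-- The generator `σ₁`. -/
def sigma1 : B3 := PresentedGroup.of 0

/-- The generator `σ₂`. -/
def sigma2 : B3 := PresentedGroup.of 1

/-- The representation of `B₃` determined by images of the generators that satisfy the
braid relation. -/
def B3.lift {G : Type*} [Group G] (a b : G) (h : a * b * a = b * a * b) : B3 →* G :=
  PresentedGroup.toGroup (f := ![a, b]) (by
    intro r hr
    obtain rfl : r = _ := hr
    simp [h])

/-- The braid `(σ₁^{m₁} σ₂^{-m₂})^n (σ₁σ₂)^{3ℓ}`, whose closure is the twisted generalized hybrid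
weaving link `Q̂₃(m₁, -m₂, n, ℓ)`. -/
def hybridWeavingBraid (m₁ m₂ n : ℕ) (ℓ : ℤ) : B3 :=
  (sigma1 ^ (m₁ : ℤ) * sigma2 ^ (-(m₂ : ℤ))) ^ n * (sigma1 * sigma2) ^ (3 * ℓ)

/-! ### Quantum numbers and quantum dimensions -/

/-- The quantum number `[k]_q = (q^k - q^{-k}) / (q - q^{-1})`. -/
noncomputable def qnum (q : ℂ) (k : ℤ) : ℂ := (q ^ k - q ^ (-k)) / (q - q⁻¹)

/-- The quantum number `[N + k]_q`, with `q^N` replaced by the variable `A`. -/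
noncomputable def qnumA (A q : ℂ) (k : ℤ) : ℂ := (A * q ^ k - A⁻¹ * q ^ (-k)) / (q - q⁻¹)

/-- `S*_{[1]} = [N]`. -/
noncomputable def S1 (A q : ℂ) : ℂ := qnumA A q 0

/-- `S*_{[3,0,0]} = [N][N+1][N+2] / ([2][3])`. -/
noncomputable def S3 (A q : ℂ) : ℂ :=
  qnumA A q 0 * qnumA A q 1 * qnumA A q 2 / (qnum q 2 * qnum q 3)

/-- `S*_{[1,1,1]} = [N][N-1][N-2] / ([2][3])`. -/
noncomputable def S111 (A q : ℂ) : ℂ :=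
  qnumA A q 0 * qnumA A q (-1) * qnumA A q (-2) / (qnum q 2 * qnum q 3)

/-- `S*_{[2,1,0]} = [N][N+1][N-1] / [3]`. -/
noncomputable def S21 (A q : ℂ) : ℂ :=
  qnumA A q 0 * qnumA A q 1 * qnumA A q (-1) / qnum q 3

/-- The values of the variables at which all denominators `q`, `A`, `q - q⁻¹`, `[2]_q`, `[3]_q` and
`S*_{[1]}` are non-zero. -/
structure Generic (q A : ℂ) : Prop where
  q_ne : q ≠ 0
  q4_ne : q ^ 4 ≠ 1
  q6_ne : q ^ 6 ≠ 1
  A_ne : A ≠ 0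
  A2_ne : A ^ 2 ≠ 1

namespace Generic

variable {q A : ℂ}

theorem sub_inv_ne (h : Generic q A) : q - q⁻¹ ≠ 0 := by
  intro h0
  have h1 : q ^ 2 = 1 := by
    have := h.q_ne
    field_simp at h0
    linear_combination h0
  exact h.q4_ne (by linear_combination (q ^ 2 + 1) * h1)

theorem qnum_two (h : Generic q A) : qnum q 2 = q + q⁻¹ := by
  have h1 := h.sub_inv_ne
  rw [qnum, div_eq_iff h1, zpow_neg, zpow_ofNat, ← inv_pow]
  ring

theorem qnum_two_ne (h : Generic q A) : qnum q 2 ≠ 0 := by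
  rw [h.qnum_two]
  intro h0
  have h1 : q ^ 2 = -1 := by
    have := h.q_ne
    field_simp at h0
    linear_combination h0
  exact h.q4_ne (by linear_combination (q ^ 2 - 1) * h1)

theorem qnum_three (h : Generic q A) : qnum q 3 = qnum q 2 ^ 2 - 1 := by
  have h1 := h.sub_inv_ne
  have h2 := mul_inv_cancel₀ h.q_ne
  rw [h.qnum_two, qnum, div_eq_iff h1, zpow_neg, zpow_ofNat, ← inv_pow]
  linear_combination (q⁻¹ - q) * h2

end Generic

/-! ### The character expansion: blocks of the braiding matrices -/

/-- A square root of `[3]_q`. -/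
noncomputable def sqrtThree (q : ℂ) : ℂ := qnum q 3 ^ (1 / 2 : ℂ)

theorem sqrtThree_sq (q : ℂ) : sqrtThree q ^ 2 = qnum q 3 := by
  rw [sqrtThree, ← Complex.cpow_nat_mul]
  simp

/-- The block `R₁^{[2,1,0]} = A⁻¹ diag(q, -q⁻¹)`. -/
noncomputable def R1block {q A : ℂ} (h : Generic q A) : (Matrix (Fin 2) (Fin 2) ℂ)ˣ where
  val := A⁻¹ • !![q, 0; 0, -q⁻¹]
  inv := A • !![q⁻¹, 0; 0, -q]
  val_inv := by
    have hq := h.q_ne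
    have hA := h.A_ne
    ext i j; fin_cases i <;> fin_cases j <;> simp <;> field_simp
  inv_val := by
    have hq := h.q_ne
    have hA := h.A_ne
    ext i j; fin_cases i <;> fin_cases j <;> simp <;> field_simp

/-- The Racah matrix
`U^{[2,1,0]} = [2]⁻¹ ((1, √[3]), (-√[3], 1))`; its inverse is its transpose, which is the conjugate
transpose when `q` is a positive real number. -/
noncomputable def Ublock {q A : ℂ} (h : Generic q A) : (Matrix (Fin 2) (Fin 2) ℂ)ˣ where
  val := (qnum q 2)⁻¹ • !![1, sqrtThree q; -sqrtThree q, 1]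
  inv := (qnum q 2)⁻¹ • !![1, -sqrtThree q; sqrtThree q, 1]
  val_inv := by
    have h2 := h.qnum_two_ne
    have h3 : sqrtThree q ^ 2 = qnum q 2 ^ 2 - 1 := by rw [sqrtThree_sq, h.qnum_three]
    ext i j; fin_cases i <;> fin_cases j <;> simp <;> field_simp <;>
      first | ring1 | linear_combination h3
  inv_val := by
    have h2 := h.qnum_two_ne
    have h3 : sqrtThree q ^ 2 = qnum q 2 ^ 2 - 1 := by rw [sqrtThree_sq, h.qnum_three]
    ext i j; fin_cases i <;> fin_cases j <;> simp <;> field_simp <;>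
      first | ring1 | linear_combination h3

/-- The block `R₂^{[2,1,0]} = U R₁ U†`. -/
noncomputable def R2block {q A : ℂ} (h : Generic q A) : (Matrix (Fin 2) (Fin 2) ℂ)ˣ :=
  Ublock h * R1block h * (Ublock h)⁻¹

theorem block_braid {q A : ℂ} (h : Generic q A) :
    R1block h * R2block h * R1block h = R2block h * R1block h * R2block h := by
  have hq := h.q_ne
  have hA := h.A_ne
  have h2 := h.qnum_two_ne
  have h3 : sqrtThree q ^ 2 = qnum q 2 ^ 2 - 1 := by rw [sqrtThree_sq, h.qnum_three]
  have ht : q ^ 2 = qnum q 2 * q - 1 := by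
    rw [h.qnum_two, add_mul, inv_mul_cancel₀ hq]; ring
  have hR2 : (R2block h : Matrix (Fin 2) (Fin 2) ℂ) = (A⁻¹ * (qnum q 2)⁻¹) •
      !![-q⁻¹ ^ 2, -sqrtThree q; -sqrtThree q, q ^ 2] := by
    change (qnum q 2)⁻¹ • !![1, sqrtThree q; -sqrtThree q, 1] * (A⁻¹ • !![q, 0; 0, -q⁻¹]) *
      ((qnum q 2)⁻¹ • !![1, -sqrtThree q; sqrtThree q, 1]) = _
    ext i j; fin_cases i <;> fin_cases j <;> simp <;> field_simp
    · linear_combination (q + qnum q 2) * ht - q * h3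
    · linear_combination -sqrtThree q * ht
    · linear_combination -sqrtThree q * ht
    · linear_combination q ^ 2 * h3 - (qnum q 2 * q + 1) * ht
  ext1
  rw [Units.val_mul, Units.val_mul, Units.val_mul, Units.val_mul, hR2]
  change (A⁻¹ • !![q, 0; 0, -q⁻¹]) * _ * (A⁻¹ • !![q, 0; 0, -q⁻¹]) =
    _ * (A⁻¹ • !![q, 0; 0, -q⁻¹]) * _
  ext i j; fin_cases i <;> fin_cases j <;> simp <;> field_simp
  · linear_combination q ^ 2 * h3 - (qnum q 2 * q + 1) * ht
  · linear_combination -sqrtThree q * ht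
  · linear_combination -sqrtThree q * ht
  · linear_combination (q + qnum q 2) * ht - q * h3

/-- The action of `B₃` on the two-dimensional multiplicity space of `[2,1,0]`. -/
noncomputable def rho21 {q A : ℂ} (h : Generic q A) : B3 →* (Matrix (Fin 2) (Fin 2) ℂ)ˣ :=
  B3.lift (R1block h) (R2block h) (block_braid h)

/-- The action of `B₃` on the one-dimensional multiplicity space of `[3,0,0]`:
`R₁ = R₂ = q / A`. -/
noncomputable def rho3 {q A : ℂ} (h : Generic q A) : B3 →* ℂˣ :=
  B3.lift (Units.mk0 (q / A) (div_ne_zero h.q_ne h.A_ne))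
    (Units.mk0 (q / A) (div_ne_zero h.q_ne h.A_ne)) rfl

/-- The action of `B₃` on the one-dimensional multiplicity space of `[1,1,1]`:
`R₁ = R₂ = -1 / (q A)`. -/
noncomputable def rho111 {q A : ℂ} (h : Generic q A) : B3 →* ℂˣ :=
  B3.lift (Units.mk0 (-1 / (q * A)) (div_ne_zero (by simp) (mul_ne_zero h.q_ne h.A_ne)))
    (Units.mk0 (-1 / (q * A)) (div_ne_zero (by simp) (mul_ne_zero h.q_ne h.A_ne))) rfl

/-- The normalized two-variable HOMFLY-PT polynomial of the closure of a 3-braid, as a character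
expansion: `(S*_{[1]})⁻¹ ∑_Ξ S*_Ξ · Tr_Ξ β` over the irreducible constituents `Ξ` of `[1]^{⊗3}`. -/
noncomputable def homflyPT {q A : ℂ} (h : Generic q A) (β : B3) : ℂ :=
  1 / S1 A q * (S3 A q * (rho3 h β : ℂ) + S111 A q * (rho111 h β : ℂ) +
    S21 A q * (rho21 h β : Matrix (Fin 2) (Fin 2) ℂ).trace)

/-! ### The quantum trace on `V ⊗ V ⊗ V`, where `V = ℂ^N` is the vector representation -/

/-- `V ⊗ V ⊗ V` for `V = ℂ^N`, in coordinates with respect to the standard basis. -/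
abbrev V3 (N : ℕ) : Type := Fin N × Fin N × Fin N → ℂ

/-- The standard braiding of `U_q(sl_N)` on the first two factors, with eigenvalues `q`, `-q⁻¹`. -/
noncomputable def Rcheck1 (N : ℕ) (q : ℂ) : Module.End ℂ (V3 N) where
  toFun f := fun (a, b, c) =>
    if a = b then q * f (a, b, c)
    else f (b, a, c) + if a < b then (q - q⁻¹) * f (a, b, c) else 0
  map_add' f g := by
    funext ⟨a, b, c⟩; simp only [Pi.add_apply]; split_ifs <;> ring
  map_smul' r f := by
    funext ⟨a, b, c⟩; simp only [Pi.smul_apply, smul_eq_mul, RingHom.id_apply]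
    split_ifs <;> ring

/-- The standard braiding of `U_q(sl_N)` on the last two factors. -/
noncomputable def Rcheck2 (N : ℕ) (q : ℂ) : Module.End ℂ (V3 N) where
  toFun f := fun (a, b, c) =>
    if b = c then q * f (a, b, c)
    else f (a, c, b) + if b < c then (q - q⁻¹) * f (a, b, c) else 0
  map_add' f g := by
    funext ⟨a, b, c⟩; simp only [Pi.add_apply]; split_ifs <;> ring
  map_smul' r f := by
    funext ⟨a, b, c⟩; simp only [Pi.smul_apply, smul_eq_mul, RingHom.id_apply]
    split_ifs <;> ring

theorem Rcheck1_sq (N : ℕ) {q : ℂ} (hq : q ≠ 0) :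
    Rcheck1 N q * Rcheck1 N q = (q - q⁻¹) • Rcheck1 N q + 1 := by
  refine LinearMap.ext fun f => funext fun ⟨a, b, c⟩ => ?_
  simp only [Rcheck1, Module.End.mul_apply, LinearMap.add_apply, LinearMap.smul_apply,
    LinearMap.coe_mk, AddHom.coe_mk, Pi.add_apply, Pi.smul_apply, smul_eq_mul,
    Module.End.one_apply]
  have hqq := mul_inv_cancel₀ hq
  split_ifs <;> first | (exfalso; omega) | linear_combination f (a, b, c) * hqq | grind

theorem Rcheck2_sq (N : ℕ) {q : ℂ} (hq : q ≠ 0) :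
    Rcheck2 N q * Rcheck2 N q = (q - q⁻¹) • Rcheck2 N q + 1 := by
  refine LinearMap.ext fun f => funext fun ⟨a, b, c⟩ => ?_
  simp only [Rcheck2, Module.End.mul_apply, LinearMap.add_apply, LinearMap.smul_apply,
    LinearMap.coe_mk, AddHom.coe_mk, Pi.add_apply, Pi.smul_apply, smul_eq_mul,
    Module.End.one_apply]
  have hqq := mul_inv_cancel₀ hq
  split_ifs <;> first | (exfalso; omega) | linear_combination f (a, b, c) * hqq | grind

theorem Rcheck_braid (N : ℕ) {q : ℂ} (hq : q ≠ 0) :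
    Rcheck1 N q * Rcheck2 N q * Rcheck1 N q = Rcheck2 N q * Rcheck1 N q * Rcheck2 N q := by
  refine LinearMap.ext fun f => funext fun ⟨a, b, c⟩ => ?_
  simp only [Rcheck1, Rcheck2, Module.End.mul_apply, LinearMap.coe_mk, AddHom.coe_mk]
  rcases lt_trichotomy a b with h1 | h1 | h1 <;> rcases lt_trichotomy b c with h2 | h2 | h2 <;>
    rcases lt_trichotomy a c with h3 | h3 | h3 <;>
    first
    | (exfalso; omega)
    | (subst_vars; simp_all [ne_of_gt, ne_of_lt, not_lt_of_gt]; try field_simp; try ring)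

/-- The invertible operator `A⁻¹ R` with `A = q^N`, for an `R` that satisfies the Hecke relation
`R² = (q - q⁻¹) R + 1`. -/
noncomputable def heckeUnit (N : ℕ) {q : ℂ} (hq : q ≠ 0) (R : Module.End ℂ (V3 N))
    (hR : R * R = (q - q⁻¹) • R + 1) : (Module.End ℂ (V3 N))ˣ where
  val := (q ^ N)⁻¹ • R
  inv := q ^ N • (R - (q - q⁻¹) • 1)
  val_inv := by
    rw [smul_mul_smul_comm, inv_mul_cancel₀ (pow_ne_zero N hq), one_smul, mul_sub, hR]
    simp
  inv_val := by
    rw [smul_mul_smul_comm, mul_inv_cancel₀ (pow_ne_zero N hq), one_smul, sub_mul, hR]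
    simp

/-- The action of `B₃` on `V ⊗ V ⊗ V`; the factor `q^{-N}` removes the dependence on framing. -/
noncomputable def piV (N : ℕ) {q : ℂ} (hq : q ≠ 0) : B3 →* (Module.End ℂ (V3 N))ˣ :=
  B3.lift (heckeUnit N hq (Rcheck1 N q) (Rcheck1_sq N hq))
    (heckeUnit N hq (Rcheck2 N q) (Rcheck2_sq N hq)) (by
      ext1
      simp only [heckeUnit, Units.val_mul, smul_mul_smul_comm, Rcheck_braid N hq])

/-- The operator `K ⊗ K ⊗ K` on `V ⊗ V ⊗ V` with
`K = diag(q^{1-N}, q^{3-N}, …, q^{N-1})`, which defines the quantum trace. -/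
noncomputable def K3 (N : ℕ) (q : ℂ) : Module.End ℂ (V3 N) where
  toFun f := fun (a, b, c) =>
    q ^ (2 * (a : ℤ) + 1 - N) * q ^ (2 * (b : ℤ) + 1 - N) * q ^ (2 * (c : ℤ) + 1 - N) *
      f (a, b, c)
  map_add' f g := by
    funext ⟨a, b, c⟩; simp only [Pi.add_apply]; ring
  map_smul' r f := by
    funext ⟨a, b, c⟩; simp only [Pi.smul_apply, smul_eq_mul, RingHom.id_apply]; ring

/-- The Reshetikhin–Turaev invariant of the closure of a 3-braid, coloured by the vector
representation of `U_q(sl_N)`: the quantum trace of the braid, divided by its value `[N]_q` on the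
unknot. -/
noncomputable def quantumTraceInvariant (N : ℕ) {q : ℂ} (hq : q ≠ 0) (β : B3) : ℂ :=
  LinearMap.trace ℂ (V3 N) (K3 N q * (piV N hq β : Module.End ℂ (V3 N))) / qnum q N

/-! ### The multiple binomial sum -/

/-- The binomial coefficient `binom(k+j-2, j-1)` for `k ≥ 1`, with the convention that
`binom(k-2, -1)` is `1` for `k = 1` and `0` for `k ≥ 2`. -/
def pathBinom (j k : ℕ) : ℕ :=
  if j = 0 then (if k = 1 then 1 else 0) else (k + j - 2).choose (j - 1)

/-- The sum `G_{m₁,-m₂,j,k,n}`, with `α = m₁ - m₂` and `(-1)^x = e^{iπx}` for real `x`. The sum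
over `k₁` runs over `0 ≤ k₁ ≤ n + 1 - 2j - k` and is empty when this bound is negative. -/
noncomputable def Gsum (m₁ m₂ : ℕ) (j k n : ℕ) (q : ℂ) : ℂ :=
  let α : ℤ := m₁ - m₂
  ∑ k₁ ∈ Finset.range (n + 2 - (2 * j + k)), ∑ k₂ ∈ Finset.Icc 0 (k - 1),
    ∑ k₃ ∈ Finset.Icc 0 (2 * j), ∑ l₁ ∈ Finset.Icc 1 2,
      ((n + 1 - (k + 2 * j)).choose k₁ : ℂ) * ((2 * j).choose k₃ : ℂ) * ((k - 1).choose k₂ : ℂ) *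
        (qnum q 3 ^ (j + k₁ + k₂) / qnum q 2 ^ (2 * n)) *
        (-1 : ℂ) ^ ((ArithmeticFunction.moebius l₁ : ℂ) *
            ((α : ℂ) * ((k : ℂ) - 1 - (n : ℂ) / 2) + (m₂ : ℂ) * ((k₂ : ℂ) - (k₁ : ℂ))) +
          (k₃ : ℂ) * ((m₂ : ℂ) + 1) - (m₁ : ℂ) * (j : ℂ)) *
        q ^ (ArithmeticFunction.moebius l₁ *
            (α * (-2 + 2 * (j : ℤ) + 2 * (k : ℤ) - (n : ℤ)) +
              2 * (m₂ : ℤ) * ((k₂ : ℤ) - (k₁ : ℤ))) +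
          2 * (m₂ : ℤ) * ((k₃ : ℤ) - (j : ℤ)))

/-- The sum `Ω(m₁, m₂, n; q)`. -/
noncomputable def Omega (m₁ m₂ n : ℕ) (q : ℂ) : ℂ :=
  ∑ j ∈ Finset.Icc 0 (n / 2), ∑ k ∈ Finset.Icc 1 (n - j),
    (-1 : ℂ) ^ (-((n : ℂ) * ((m₁ : ℂ) - (m₂ : ℂ))) / 2) *
      (pathBinom j k : ℂ) * ((n - (k + j - 1)).choose j : ℂ) * Gsum m₁ m₂ j k n q

/-! The formula for the character expansion and its agreement with the quantum trace have separate
reasons.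

The one-dimensional blocks see only the exponent sum nα + 6ℓ of the braid. On the block [2,1,0] the
full twist (σ₁σ₂)³ is the scalar A⁻⁶ (`R1block_mul_R2block_cube`), so what remains is the trace of
the n-th power of the 2×2 matrix of σ₁^{m₁}σ₂^{-m₂}. Such a trace is a weighted count of closed
walks on two vertices (`trace_matrix_pow`). Sorting the walks by the number j of excursions and the
number k - 1 of loops at the vertex visited gives the two outer binomials of Ω. Each loop weight is
a monomial times a two-term sum, and the excursion weight contains the square of one. Expanding the
three powers gives k₁, k₂, k₃, and the two base vertices of the walks are the two values of ℓ₁, with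
μ = ±1 (`neg_one_cpow_mul_Gsum`).

For A = q^N, the quantum trace and the character expansion are linear functionals on one product
algebra, where both generators satisfy the same Hecke quadratic relation. Every braid then maps into
the span of six words (`map_mem_heckeSpan`), and cyclicity leaves only 1, σ₁, σ₂, σ₁σ₂ to compare
(`eq_zero_of_mem_heckeSpan`). On these, the quantum trace comes from a telescoping sum
(`sum_kDiag_mul_braidingDiag`) and the expansion from `Generic.dim_identities`. -/

/-- The character expansions of the Markov trace at the words `1`, `σ₁` and `σ₁σ₂`. -/
theorem Generic.dim_identities {q A : ℂ} (h : Generic q A) :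
    S3 A q + S111 A q + S21 A q * 2 = qnumA A q 0 ^ 3 ∧
    S3 A q * (q / A) + S111 A q * (-1 / (q * A)) + S21 A q * ((q - q⁻¹) * A⁻¹) =
      qnumA A q 0 ^ 2 ∧
    S3 A q * (q / A * (q / A)) + S111 A q * (-1 / (q * A) * (-1 / (q * A))) +
      S21 A q * (-A⁻¹ ^ 2) = qnumA A q 0 := by
  have hq := h.q_ne
  have hA := h.A_ne
  have h2 : q ^ 2 + 1 ≠ 0 := fun h0 => h.q4_ne (by linear_combination (q ^ 2 - 1) * h0)
  have h1 : q ^ 2 - 1 ≠ 0 := fun h0 => h.q4_ne (by linear_combination (q ^ 2 + 1) * h0)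
  have h3 : q ^ 2 * (q ^ 2 + 1) + 1 ≠ 0 := fun h0 => h.q6_ne (by linear_combination (q ^ 2 - 1) * h0)
  have e2 : qnum q 2 = (q ^ 2 + 1) / q := by
    rw [h.qnum_two]; field_simp
  have e3 : qnum q 3 = (q ^ 2 * (q ^ 2 + 1) + 1) / q ^ 2 := by
    rw [h.qnum_three, e2]; field_simp; ring
  have e : ∀ k : ℤ, qnumA A q k = (A * q ^ k - A⁻¹ * q ^ (-k)) * (q / (q ^ 2 - 1)) := by
    intro k
    have : q - q⁻¹ = (q ^ 2 - 1) / q := by field_simp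
    rw [qnumA, this]; field_simp
  have z1 : q ^ (-1 : ℤ) = q⁻¹ := by simp
  have z2 : q ^ (-2 : ℤ) = (q ^ 2)⁻¹ := by rw [zpow_neg]; norm_cast
  simp only [S3, S111, S21, e, e2, e3, neg_neg, neg_zero, z1, z2, zpow_ofNat]
  refine ⟨?_, ?_, ?_⟩ <;> field_simp <;> ring

/-! ### The Hecke algebra on three strands -/

/-- The span of the six standard words `1, x, y, xy, yx, xyx`. -/
def heckeSpan {P : Type*} [Ring P] [Algebra ℂ P] (x y : P) : Submodule ℂ P :=
  Submodule.span ℂ {1, x, y, x * y, y * x, x * y * x}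

section HeckeSpan

variable {P : Type*} [Ring P] [Algebra ℂ P] {x y : P} {γ δ : ℂ}

/-- The quadratic relations remove repeated letters, and the braid relation turns yxy into xyx and
y·xyx into xy·x², so left multiplication never leads out of the six words. -/
theorem mul_mem_heckeSpan (hx : x * x = γ • x + δ • 1) (hy : y * y = γ • y + δ • 1)
    (hxy : x * y * x = y * x * y) {p : P} (hp : p ∈ heckeSpan x y) :
    x * p ∈ heckeSpan x y ∧ y * p ∈ heckeSpan x y := by
  have mem : ∀ w ∈ ({1, x, y, x * y, y * x, x * y * x} : Set P), w ∈ heckeSpan x y :=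
    fun w hw => Submodule.subset_span hw
  have h1 := mem 1 (by simp)
  have h2 := mem x (by simp)
  have h3 := mem y (by simp)
  have h4 := mem (x * y) (by simp)
  have h5 := mem (y * x) (by simp)
  have h6 := mem (x * y * x) (by simp)
  have comb : ∀ {u v : P}, u ∈ heckeSpan x y → v ∈ heckeSpan x y →
      γ • u + δ • v ∈ heckeSpan x y :=
    fun hu hv => add_mem (Submodule.smul_mem _ _ hu) (Submodule.smul_mem _ _ hv)
  have hxx : ∀ u, x * (x * u) = γ • (x * u) + δ • u := fun u => by
    rw [← mul_assoc, hx]; simp [add_mul]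
  have hyy : ∀ u, y * (y * u) = γ • (y * u) + δ • u := fun u => by
    rw [← mul_assoc, hy]; simp [add_mul]
  induction hp using Submodule.span_induction with
  | mem w hw =>
    simp only [Set.mem_insert_iff, Set.mem_singleton_iff] at hw
    rcases hw with rfl | rfl | rfl | rfl | rfl | rfl
    · simpa using ⟨h2, h3⟩
    · exact ⟨hx ▸ comb h2 h1, h5⟩
    · exact ⟨h4, hy ▸ comb h3 h1⟩
    · exact ⟨hxx y ▸ comb h4 h3, by rw [← mul_assoc, ← hxy]; exact h6⟩
    · exact ⟨by rwa [← mul_assoc], hyy x ▸ comb h5 h2⟩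
    · refine ⟨?_, ?_⟩
      · rw [mul_assoc, hxx, ← mul_assoc]
        exact comb h6 h5
      · have : y * (x * y * x) = γ • (x * y * x) + δ • (x * y) := by
          rw [← mul_assoc, ← mul_assoc, ← hxy, mul_assoc (x * y), hx]
          simp [mul_add]
        exact this ▸ comb h6 h4
  | zero => simp
  | add u v _ _ hu hv =>
    exact ⟨mul_add x u v ▸ add_mem hu.1 hv.1, mul_add y u v ▸ add_mem hu.2 hv.2⟩
  | smul c u _ hu =>
    exact ⟨mul_smul_comm c x u ▸ Submodule.smul_mem _ _ hu.1,
      mul_smul_comm c y u ▸ Submodule.smul_mem _ _ hu.2⟩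

/-- The image of a braid under a representation that factors through the Hecke algebra is a
combination of the six standard words. -/
theorem map_mem_heckeSpan (φ : B3 →* Pˣ) (hδ : δ ≠ 0)
    (hx : (φ sigma1 : P) * φ sigma1 = γ • (φ sigma1 : P) + δ • 1)
    (hy : (φ sigma2 : P) * φ sigma2 = γ • (φ sigma2 : P) + δ • 1) (β : B3) :
    (φ β : P) ∈ heckeSpan (φ sigma1 : P) (φ sigma2 : P) := by
  have hbraid : sigma1 * sigma2 * sigma1 = sigma2 * sigma1 * sigma2 := by
    have : sigma1 * sigma2 * sigma1 * (sigma2 * sigma1 * sigma2)⁻¹ = 1 :=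
      PresentedGroup.one_of_mem (rels := artinRels) rfl
    exact mul_inv_eq_one.mp this
  have hxy : (φ sigma1 : P) * φ sigma2 * φ sigma1 = φ sigma2 * φ sigma1 * φ sigma2 := by
    simp only [← Units.val_mul, ← map_mul, hbraid]
  have key : ∀ p ∈ heckeSpan (φ sigma1 : P) (φ sigma2 : P), _ :=
    fun p hp => mul_mem_heckeSpan hx hy hxy hp
  -- The quadratic relation makes the inverse of a generator linear in the generator, so inverse
  -- letters need no new words.
  have inv_eq : ∀ u : Pˣ, (u : P) * u = γ • (u : P) + δ • 1 →
      ((u⁻¹ : Pˣ) : P) = δ⁻¹ • ((u : P) - γ • 1) := by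
    intro u hu
    have : (u : P) * (δ⁻¹ • ((u : P) - γ • 1)) = 1 := by
      rw [mul_smul_comm, mul_sub, hu]
      simp [hδ]
    exact Units.inv_eq_of_mul_eq_one_right this
  have hβ : β ∈ Subgroup.closure (Set.range (PresentedGroup.of (rels := artinRels))) := by
    rw [PresentedGroup.closure_range_of]; trivial
  induction hβ using Subgroup.closure_induction_left with
  | one => exact Submodule.subset_span (by simp)
  | mul_left g hg b _ ih =>
    obtain ⟨i, rfl⟩ := hg
    rw [map_mul, Units.val_mul]
    fin_cases i
    · exact (key _ ih).1
    · exact (key _ ih).2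
  | inv_mul_cancel g hg b _ ih =>
    obtain ⟨i, rfl⟩ := hg
    rw [map_mul, Units.val_mul, map_inv]
    fin_cases i
    · change ((φ sigma1)⁻¹ : Pˣ).val * _ ∈ _
      rw [inv_eq _ hx, smul_mul_assoc, sub_mul, smul_mul_assoc, one_mul]
      exact Submodule.smul_mem _ _ (sub_mem (key _ ih).1 (Submodule.smul_mem _ _ ih))
    · change ((φ sigma2)⁻¹ : Pˣ).val * _ ∈ _
      rw [inv_eq _ hy, smul_mul_assoc, sub_mul, smul_mul_assoc, one_mul]
      exact Submodule.smul_mem _ _ (sub_mem (key _ ih).2 (Submodule.smul_mem _ _ ih))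

/-- A functional that vanishes on the four words `1, x, y, xy` and is invariant under cyclic
permutation of a factor `x` vanishes on the whole span. -/
theorem eq_zero_of_mem_heckeSpan (hx : x * x = γ • x + δ • 1) (L : P →ₗ[ℂ] ℂ)
    (hL : ∀ p, L (p * x) = L (x * p)) (h1 : L 1 = 0) (h2 : L x = 0) (h3 : L y = 0)
    (h4 : L (x * y) = 0) {p : P} (hp : p ∈ heckeSpan x y) : L p = 0 := by
  have : heckeSpan x y ≤ LinearMap.ker L := by
    rw [heckeSpan, Submodule.span_le]
    intro w hw
    simp only [Set.mem_insert_iff, Set.mem_singleton_iff] at hw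
    rcases hw with rfl | rfl | rfl | rfl | rfl | rfl
    · exact h1
    · exact h2
    · exact h3
    · exact h4
    · exact (hL y).trans h4
    -- Moving the last x to the front turns xyx into x²y, which reduces to xy and y.
    · change L _ = 0
      rw [hL, ← mul_assoc, hx]
      simp [add_mul, h3, h4]
  exact this hp

end HeckeSpan

theorem B3.lift_sigma1 {G : Type*} [Group G] (a b : G) (h : a * b * a = b * a * b) :
    B3.lift a b h sigma1 = a :=
  PresentedGroup.toGroup.of _

theorem B3.lift_sigma2 {G : Type*} [Group G] (a b : G) (h : a * b * a = b * a * b) :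
    B3.lift a b h sigma2 = b :=
  PresentedGroup.toGroup.of _

/-! ### The Markov trace on `V ⊗ V ⊗ V` -/

/-- The diagonal entries of the braiding on `V ⊗ V`. -/
noncomputable def braidingDiag {N : ℕ} (q : ℂ) (a b : Fin N) : ℂ :=
  if a = b then q else if a < b then q - q⁻¹ else 0

/-- The diagonal entries of `K`. -/
noncomputable def kDiag (N : ℕ) (q : ℂ) (a : Fin N) : ℂ := q ^ (2 * (a : ℤ) + 1 - N)

theorem trace_K3_mul (N : ℕ) (q : ℂ) (f : Module.End ℂ (V3 N)) :
    LinearMap.trace ℂ (V3 N) (K3 N q * f) =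
      ∑ a, ∑ b, ∑ c, kDiag N q a * kDiag N q b * kDiag N q c *
        f (Pi.single (a, b, c) 1) (a, b, c) := by
  rw [LinearMap.trace_eq_matrix_trace ℂ (Pi.basisFun ℂ _), Matrix.trace,
    Fintype.sum_prod_type]
  refine Finset.sum_congr rfl fun a _ => ?_
  rw [Fintype.sum_prod_type]
  refine Finset.sum_congr rfl fun b _ => Finset.sum_congr rfl fun c _ => ?_
  simp [K3, kDiag]

theorem sub_inv_mul_kDiag {N : ℕ} {q : ℂ} (hq : q ≠ 0) (a : Fin N) :
    (q - q⁻¹) * kDiag N q a = q ^ (2 * ((a + 1 : ℕ) : ℤ) - N) - q ^ (2 * (a : ℤ) - N) := by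
  have e1 : q ^ (2 * ((a + 1 : ℕ) : ℤ) - N) = kDiag N q a * q := by
    rw [kDiag, ← zpow_add_one₀ hq]; congr 1; push_cast; ring
  have e2 : q ^ (2 * (a : ℤ) - N) = kDiag N q a * q⁻¹ := by
    rw [kDiag, ← zpow_sub_one₀ hq]; congr 1; ring
  rw [e1, e2]; ring

theorem sum_kDiag (N : ℕ) {q : ℂ} (hq : q ≠ 0) (hq' : q - q⁻¹ ≠ 0) :
    ∑ a, kDiag N q a = qnum q N := by
  rw [qnum, eq_div_iff hq', mul_comm, Finset.mul_sum]
  simp only [sub_inv_mul_kDiag hq]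
  rw [Fin.sum_univ_eq_sum_range
    (fun m : ℕ => q ^ (2 * ((m + 1 : ℕ) : ℤ) - N) - q ^ (2 * (m : ℤ) - N)),
    Finset.sum_range_sub (fun m : ℕ => q ^ (2 * (m : ℤ) - N))]
  congr 2 <;> push_cast <;> ring

/-- This is the Markov property: closing off one strand of a crossing gives the framing factor q^N,
independently of b. The terms c > b telescope, the term c = b supplies their missing lower end, and
the terms c < b vanish. -/
theorem sum_kDiag_mul_braidingDiag (N : ℕ) {q : ℂ} (hq : q ≠ 0) (b : Fin N) :
    ∑ c, kDiag N q c * braidingDiag q b c = q ^ N := by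
  -- An antiderivative of the summand, cut off at b; since b < N, its value at N is q^N.
  let T : ℕ → ℂ := fun m => if m ≤ b then 0 else q ^ (2 * (m : ℤ) - N)
  have h : ∀ c : Fin N, kDiag N q c * braidingDiag q b c = T (c + 1) - T c := by
    intro c
    have h1 := sub_inv_mul_kDiag hq c
    rcases lt_trichotomy b c with hbc | rfl | hbc
    · have : (b : ℕ) < c := hbc
      simp only [T, braidingDiag, if_neg hbc.ne, if_pos hbc, if_neg this.not_ge,
        if_neg (show ¬ (c + 1 : ℕ) ≤ b by omega), ← h1]
      ring
    · simp only [T, braidingDiag, if_true, le_refl, kDiag, if_neg (show ¬ (b + 1 : ℕ) ≤ b by omega),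
        ← zpow_add_one₀ hq, sub_zero]
      congr 1; push_cast; ring
    · have : (c : ℕ) < b := hbc
      simp only [T, braidingDiag, if_neg hbc.ne', if_neg hbc.not_gt, if_pos this.le,
        if_pos (show (c + 1 : ℕ) ≤ b by omega)]
      ring
  rw [Finset.sum_congr rfl fun c _ => h c,
    Fin.sum_univ_eq_sum_range (fun m : ℕ => T (m + 1) - T m), Finset.sum_range_sub T]
  simp only [T, Nat.zero_le, if_true, if_neg b.isLt.not_ge, sub_zero]
  rw [← zpow_natCast]; congr 1; ring

theorem trace_K3 (N : ℕ) {q : ℂ} (hq : q ≠ 0) (hq' : q - q⁻¹ ≠ 0) :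
    LinearMap.trace ℂ (V3 N) (K3 N q) = qnum q N ^ 3 := by
  rw [← mul_one (K3 N q), trace_K3_mul]
  simp only [Module.End.one_apply, Pi.single_eq_same, mul_one, ← Finset.mul_sum,
    ← Finset.sum_mul, sum_kDiag N hq hq']
  ring

theorem trace_K3_mul_Rcheck1 (N : ℕ) {q : ℂ} (hq : q ≠ 0) (hq' : q - q⁻¹ ≠ 0) :
    LinearMap.trace ℂ (V3 N) (K3 N q * Rcheck1 N q) = q ^ N * qnum q N ^ 2 := by
  have h : ∀ a b c, Rcheck1 N q (Pi.single (a, b, c) 1) (a, b, c) = braidingDiag q a b := by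
    intro a b c
    simp only [Rcheck1, braidingDiag, LinearMap.coe_mk, AddHom.coe_mk, Pi.single_apply]
    split_ifs <;> simp_all
  have h' : ∀ a b c, kDiag N q a * kDiag N q b * kDiag N q c * braidingDiag q a b =
      kDiag N q a * (kDiag N q b * braidingDiag q a b) * kDiag N q c := fun a b c => by ring
  simp only [trace_K3_mul, h, h', ← Finset.mul_sum, ← Finset.sum_mul, sum_kDiag N hq hq',
    sum_kDiag_mul_braidingDiag N hq]
  ring

theorem trace_K3_mul_Rcheck2 (N : ℕ) {q : ℂ} (hq : q ≠ 0) (hq' : q - q⁻¹ ≠ 0) :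
    LinearMap.trace ℂ (V3 N) (K3 N q * Rcheck2 N q) = q ^ N * qnum q N ^ 2 := by
  have h : ∀ a b c, Rcheck2 N q (Pi.single (a, b, c) 1) (a, b, c) = braidingDiag q b c := by
    intro a b c
    simp only [Rcheck2, braidingDiag, LinearMap.coe_mk, AddHom.coe_mk, Pi.single_apply]
    split_ifs <;> simp_all
  simp only [trace_K3_mul, h, mul_assoc, ← Finset.mul_sum, ← Finset.sum_mul, sum_kDiag N hq hq',
    sum_kDiag_mul_braidingDiag N hq]
  ring

/-- If the first braiding swaps distinct labels, the label in position 1 changes and the second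
braiding cannot restore it. Hence only the diagonal parts contribute to a diagonal entry of the
product. -/
theorem trace_K3_mul_Rcheck1_mul_Rcheck2 (N : ℕ) {q : ℂ} (hq : q ≠ 0) (hq' : q - q⁻¹ ≠ 0) :
    LinearMap.trace ℂ (V3 N) (K3 N q * (Rcheck1 N q * Rcheck2 N q)) =
      (q ^ N) ^ 2 * qnum q N := by
  have h : ∀ a b c, (Rcheck1 N q * Rcheck2 N q) (Pi.single (a, b, c) 1) (a, b, c) =
      braidingDiag q a b * braidingDiag q b c := by
    intro a b c
    simp only [Rcheck1, Rcheck2, braidingDiag, Module.End.mul_apply, LinearMap.coe_mk,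
      AddHom.coe_mk, Pi.single_apply, Prod.mk.injEq]
    split_ifs <;> grind
  have h' : ∀ a b c, kDiag N q a * kDiag N q b * kDiag N q c *
      (braidingDiag q a b * braidingDiag q b c) = kDiag N q a *
        ((kDiag N q b * braidingDiag q a b) * (kDiag N q c * braidingDiag q b c)) :=
    fun a b c => by ring
  simp only [trace_K3_mul, h, h', ← Finset.mul_sum, ← Finset.sum_mul, sum_kDiag N hq hq',
    sum_kDiag_mul_braidingDiag N hq]
  ring

/-- The weight of K ⊗ K ⊗ K is symmetric in the labels; this makes the quantum trace invariant under
cycling a factor σ₁. -/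
theorem K3_mul_Rcheck1 (N : ℕ) (q : ℂ) : K3 N q * Rcheck1 N q = Rcheck1 N q * K3 N q := by
  refine LinearMap.ext fun f => funext fun ⟨a, b, c⟩ => ?_
  simp only [K3, Rcheck1, Module.End.mul_apply, LinearMap.coe_mk, AddHom.coe_mk]
  split_ifs <;> ring

/-! ### The quantum trace as a character expansion -/

theorem R2block_val {q A : ℂ} (h : Generic q A) :
    (R2block h : Matrix (Fin 2) (Fin 2) ℂ) = (A⁻¹ * (qnum q 2)⁻¹) •
      !![-q⁻¹ ^ 2, -sqrtThree q; -sqrtThree q, q ^ 2] := by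
  have hq := h.q_ne
  have hA := h.A_ne
  have h2 := h.qnum_two_ne
  have h3 : sqrtThree q ^ 2 = qnum q 2 ^ 2 - 1 := by rw [sqrtThree_sq, h.qnum_three]
  have ht : q ^ 2 = qnum q 2 * q - 1 := by
    rw [h.qnum_two, add_mul, inv_mul_cancel₀ hq]; ring
  change (qnum q 2)⁻¹ • !![1, sqrtThree q; -sqrtThree q, 1] * (A⁻¹ • !![q, 0; 0, -q⁻¹]) *
    ((qnum q 2)⁻¹ • !![1, -sqrtThree q; sqrtThree q, 1]) = _
  ext i j; fin_cases i <;> fin_cases j <;> simp <;> field_simp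
  · linear_combination (q + qnum q 2) * ht - q * h3
  · linear_combination -sqrtThree q * ht
  · linear_combination -sqrtThree q * ht
  · linear_combination q ^ 2 * h3 - (qnum q 2 * q + 1) * ht

theorem R1block_val {q A : ℂ} (h : Generic q A) :
    (R1block h : Matrix (Fin 2) (Fin 2) ℂ) = A⁻¹ • !![q, 0; 0, -q⁻¹] := rfl

theorem R1block_sq {q A : ℂ} (h : Generic q A) :
    (R1block h : Matrix (Fin 2) (Fin 2) ℂ) * R1block h =
      ((q - q⁻¹) * A⁻¹) • (R1block h : Matrix (Fin 2) (Fin 2) ℂ) + (A⁻¹ ^ 2) • 1 := by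
  have hq := h.q_ne
  have hA := h.A_ne
  rw [R1block_val]
  ext i j; fin_cases i <;> fin_cases j <;> simp <;> field_simp <;> ring

theorem R2block_sq {q A : ℂ} (h : Generic q A) :
    (R2block h : Matrix (Fin 2) (Fin 2) ℂ) * R2block h =
      ((q - q⁻¹) * A⁻¹) • (R2block h : Matrix (Fin 2) (Fin 2) ℂ) + (A⁻¹ ^ 2) • 1 := by
  have : (R2block h : Matrix (Fin 2) (Fin 2) ℂ) * R2block h =
      (Ublock h).val * ((R1block h).val * (R1block h).val) * (Ublock h)⁻¹.val := by
    simp only [R2block, ← Units.val_mul]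
    congr 1
    group
  rw [this, R1block_sq, R2block, mul_add, add_mul]
  simp

/-- The simultaneous action of `B₃` on `V ⊗ V ⊗ V` and on the multiplicity spaces. -/
noncomputable def totalRep (N : ℕ) {q A : ℂ} (h : Generic q A) :
    B3 →* (Module.End ℂ (V3 N) × ℂ × ℂ × Matrix (Fin 2) (Fin 2) ℂ)ˣ :=
  MulEquiv.prodUnits.symm.toMonoidHom.comp ((piV N h.q_ne).prod
    (MulEquiv.prodUnits.symm.toMonoidHom.comp ((rho3 h).prod
      (MulEquiv.prodUnits.symm.toMonoidHom.comp ((rho111 h).prod (rho21 h))))))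

theorem totalRep_val (N : ℕ) {q A : ℂ} (h : Generic q A) (β : B3) :
    (totalRep N h β).val = ((piV N h.q_ne β).val, (rho3 h β).val, (rho111 h β).val,
      (rho21 h β).val) := rfl

/-- The difference between the quantum trace and its character expansion. -/
noncomputable def traceDefect (N : ℕ) (q A : ℂ) :
    Module.End ℂ (V3 N) × ℂ × ℂ × Matrix (Fin 2) (Fin 2) ℂ →ₗ[ℂ] ℂ where
  toFun p := LinearMap.trace ℂ (V3 N) (K3 N q * p.1) -
    (S3 A q * p.2.1 + S111 A q * p.2.2.1 + S21 A q * p.2.2.2.trace)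
  map_add' p r := by simp [mul_add]; ring
  map_smul' c p := by simp; ring

theorem totalRep_sigma1 (N : ℕ) {q A : ℂ} (h : Generic q A) :
    (totalRep N h sigma1).val = ((q ^ N)⁻¹ • Rcheck1 N q, q / A, -1 / (q * A),
      (R1block h).val) := by
  simp only [totalRep_val, piV, rho3, rho111, rho21, B3.lift_sigma1]
  rfl

theorem totalRep_sigma2 (N : ℕ) {q A : ℂ} (h : Generic q A) :
    (totalRep N h sigma2).val = ((q ^ N)⁻¹ • Rcheck2 N q, q / A, -1 / (q * A),
      (R2block h).val) := by
  simp only [totalRep_val, piV, rho3, rho111, rho21, B3.lift_sigma2]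
  rfl

theorem qnumA_pow {N : ℕ} {q : ℂ} : qnumA (q ^ N) q 0 = qnum q N := by
  simp [qnumA, qnum]

/-- All four components satisfy x² = γx + δ with the same γ = (q - q⁻¹)/A and δ = A⁻²; on V ⊗ V ⊗ V
this uses A = q^N. The Hecke span argument therefore applies once, to the product algebra. -/
theorem traceDefect_totalRep (N : ℕ) {q A : ℂ} (h : Generic q A) (hA : A = q ^ N) (β : B3) :
    traceDefect N q A (totalRep N h β).val = 0 := by
  have hq := h.q_ne
  have hA0 := h.A_ne
  have hqq := h.sub_inv_ne
  have h2 := h.qnum_two_ne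
  have hN : qnum q N = qnumA A q 0 := by rw [hA, qnumA_pow]
  have hx : (totalRep N h sigma1).val * (totalRep N h sigma1).val =
      ((q - q⁻¹) * A⁻¹) • (totalRep N h sigma1).val + (A⁻¹ ^ 2) • 1 := by
    rw [totalRep_sigma1]
    refine Prod.ext ?_ (Prod.ext ?_ (Prod.ext ?_ (R1block_sq h)))
    · change ((q ^ N)⁻¹ • Rcheck1 N q) * ((q ^ N)⁻¹ • Rcheck1 N q) = _ • (q ^ N)⁻¹ • Rcheck1 N q +
        A⁻¹ ^ 2 • 1
      rw [smul_mul_smul_comm, Rcheck1_sq N hq, ← hA]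
      module
    · simp; field_simp; ring
    · simp; field_simp; ring
  have hy : (totalRep N h sigma2).val * (totalRep N h sigma2).val =
      ((q - q⁻¹) * A⁻¹) • (totalRep N h sigma2).val + (A⁻¹ ^ 2) • 1 := by
    rw [totalRep_sigma2]
    refine Prod.ext ?_ (Prod.ext ?_ (Prod.ext ?_ (R2block_sq h)))
    · change ((q ^ N)⁻¹ • Rcheck2 N q) * ((q ^ N)⁻¹ • Rcheck2 N q) = _ • (q ^ N)⁻¹ • Rcheck2 N q +
        A⁻¹ ^ 2 • 1
      rw [smul_mul_smul_comm, Rcheck2_sq N hq, ← hA]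
      module
    · simp; field_simp; ring
    · simp; field_simp; ring
  obtain ⟨d0, d1, d2⟩ := h.dim_identities
  have t1 : (R1block h).val.trace = (q - q⁻¹) * A⁻¹ := by
    rw [R1block_val]; simp [Matrix.trace_fin_two]; ring
  have t2 : (R2block h).val.trace = (q - q⁻¹) * A⁻¹ := by
    rw [← t1, R2block, Units.val_mul, Matrix.trace_mul_comm, Units.val_mul,
      Units.inv_mul_cancel_left]
  have t12 : ((R1block h).val * (R2block h).val).trace = -A⁻¹ ^ 2 := by
    rw [R1block_val, R2block_val]
    simp only [smul_mul_smul_comm, Matrix.trace_smul, Matrix.mul_fin_two, Matrix.trace_fin_two_of,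
      smul_eq_mul]
    have : q * -q⁻¹ ^ 2 + 0 * -sqrtThree q + (0 * -sqrtThree q + -q⁻¹ * q ^ 2) = -qnum q 2 := by
      rw [h.qnum_two]; field_simp; ring
    rw [this]
    field_simp
  refine eq_zero_of_mem_heckeSpan hx (traceDefect N q A) ?_ ?_ ?_ ?_ ?_
    (map_mem_heckeSpan (totalRep N h) (pow_ne_zero 2 (inv_ne_zero hA0)) hx hy β)
  · rintro ⟨p₁, p₂, p₃, p₄⟩
    have ht : LinearMap.trace ℂ (V3 N) (K3 N q * (p₁ * Rcheck1 N q)) =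
        LinearMap.trace ℂ (V3 N) (K3 N q * (Rcheck1 N q * p₁)) := by
      rw [← mul_assoc, LinearMap.trace_mul_comm, ← mul_assoc, ← mul_assoc, K3_mul_Rcheck1]
    rw [totalRep_sigma1]
    simp only [traceDefect, LinearMap.coe_mk, AddHom.coe_mk, Prod.mk_mul_mk, mul_smul_comm,
      smul_mul_assoc, map_smul, ht, Matrix.trace_mul_comm p₄, mul_comm p₂, mul_comm p₃]
  · simp only [traceDefect, LinearMap.coe_mk, AddHom.coe_mk, Prod.fst_one, Prod.snd_one, mul_one,
      trace_K3 N hq hqq, hN, Matrix.trace_one]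
    rw [← d0]
    simp
  · rw [totalRep_sigma1]
    simp only [traceDefect, LinearMap.coe_mk, AddHom.coe_mk, mul_smul_comm, map_smul, smul_eq_mul,
      trace_K3_mul_Rcheck1 N hq hqq, hN, ← hA, inv_mul_cancel_left₀ hA0, t1, d1, sub_self]
  · rw [totalRep_sigma2]
    simp only [traceDefect, LinearMap.coe_mk, AddHom.coe_mk, mul_smul_comm, map_smul, smul_eq_mul,
      trace_K3_mul_Rcheck2 N hq hqq, hN, ← hA, inv_mul_cancel_left₀ hA0, t2, d1, sub_self]
  · rw [totalRep_sigma1, totalRep_sigma2]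
    simp only [traceDefect, LinearMap.coe_mk, AddHom.coe_mk, Prod.mk_mul_mk, smul_mul_assoc,
      mul_smul_comm, map_smul, smul_eq_mul,
      trace_K3_mul_Rcheck1_mul_Rcheck2 N hq hqq, hN, ← hA, t12, d2]
    field_simp
    ring

/-- For `A = q^N`, the quantum trace on `V ⊗ V ⊗ V` is the HOMFLY-PT polynomial. -/
theorem quantumTraceInvariant_eq_homflyPT (N : ℕ) {q A : ℂ} (h : Generic q A) (hA : A = q ^ N)
    (β : B3) : quantumTraceInvariant N h.q_ne β = homflyPT h β := by
  have := sub_eq_zero.mp (traceDefect_totalRep N h hA β)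
  have hN : qnum q N = qnumA A q 0 := by rw [hA, qnumA_pow]
  rw [quantumTraceInvariant, homflyPT, S1, hN, div_eq_inv_mul, one_div]
  exact congrArg _ this

/-! ### Powers of two-by-two matrices -/

open PowerSeries in
/-- The generating function, by length, of the walks from a vertex to itself in the two-vertex graph
with loops of weights `a` and `d`, that make exactly `j` excursions to the other vertex. -/
noncomputable def excursionSeries (a d : ℂ) (j : ℕ) : PowerSeries ℂ :=
  X ^ (2 * j) * (mk fun n => a ^ n) ^ (j + 1) * (mk fun n => d ^ n) ^ j

open PowerSeries in
theorem mk_pow_eq_one_add (a : ℂ) :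
    (mk fun n => a ^ n) = 1 + X * (C a * mk fun n => a ^ n) := by
  ext n
  cases n with
  | zero => simp
  | succ n => simp [coeff_succ_X_mul, coeff_one, pow_succ']

open PowerSeries in
theorem coeff_mk_pow_pow (a : ℂ) (j n : ℕ) :
    coeff n ((mk fun n => a ^ n) ^ (j + 1)) = ((j + n).choose j : ℂ) * a ^ n := by
  have : (mk fun n => a ^ n) = rescale a (mk 1) := by ext; simp [coeff_rescale]
  rw [this, ← map_pow, mk_one_pow_eq_mk_choose_add, coeff_rescale, coeff_mk, mul_comm]

-- The convention for j = 0 in `pathBinom` is exactly what this needs: the zeroth power of the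
-- series is 1.
open PowerSeries in
theorem coeff_mk_pow_pow_pathBinom (d : ℂ) (j p : ℕ) :
    coeff p ((mk fun n => d ^ n) ^ j) = (pathBinom j (p + 1) : ℂ) * d ^ p := by
  cases j with
  | zero => cases p <;> simp [pathBinom, coeff_one]
  | succ j =>
    rw [coeff_mk_pow_pow, pathBinom, if_neg (by omega)]
    congr 3
    omega

-- Here p counts the loops of weight d, spread over j visits; the other n - 2j - p loops have weight
-- a and are spread over j + 1 visits.
open PowerSeries in
theorem coeff_excursionSeries (a d : ℂ) (j n : ℕ) (hn : 2 * j ≤ n) :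
    coeff n (excursionSeries a d j) = ∑ p ∈ Finset.range (n - 2 * j + 1),
      (pathBinom j (p + 1) : ℂ) * ((n - (p + j)).choose j : ℂ) *
        (d ^ p * a ^ (n - 2 * j - p)) := by
  obtain ⟨m, rfl⟩ := Nat.exists_eq_add_of_le' hn
  rw [excursionSeries, mul_assoc, coeff_X_pow_mul, mul_comm, coeff_mul,
    Finset.Nat.sum_antidiagonal_eq_sum_range_succ_mk, Nat.add_sub_cancel]
  refine Finset.sum_congr rfl fun p hp => ?_
  have hp : p ≤ m := by simpa [Nat.lt_succ_iff] using hp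
  rw [coeff_mk_pow_pow_pathBinom, coeff_mk_pow_pow,
    show m + 2 * j - (p + j) = j + (m - p) by omega]
  ring

open PowerSeries in
/-- Powers of a two-by-two matrix, as a sum over the number of excursions. -/
theorem matrix_pow_eq_sum_coeff (M : Matrix (Fin 2) (Fin 2) ℂ) (J n : ℕ) (hn : n < 2 * J) :
    (M ^ n) 0 0 = ∑ j ∈ Finset.range J,
        (M 0 1 * M 1 0) ^ j * coeff n (excursionSeries (M 0 0) (M 1 1) j) ∧
      (M ^ n) 1 0 = M 1 0 * ∑ j ∈ Finset.range J, (M 0 1 * M 1 0) ^ j *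
        coeff n (X * ((mk fun n => M 1 1 ^ n) * excursionSeries (M 0 0) (M 1 1) j)) := by
  obtain ⟨I, rfl⟩ : ∃ I, J = I + 1 := ⟨J - 1, by omega⟩
  set a := M 0 0
  set b := M 0 1
  set c := M 1 0
  set d := M 1 1
  set U := excursionSeries a d with hU
  -- V j counts walks that have completed j excursions and are now on the next one. A last-step
  -- decomposition gives the recurrences `hVU` and `hUV`.
  set V : ℕ → PowerSeries ℂ := fun j => X * ((mk fun n => d ^ n) * U j) with hV
  have hVU : ∀ n j, coeff (n + 1) (V j) = coeff n (U j) + d * coeff n (V j) := fun n j => by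
    have : V j = X * (U j + C d * V j) := by
      simp only [hV]
      conv_lhs => rw [mk_pow_eq_one_add d]
      ring
    conv_lhs => rw [this, coeff_succ_X_mul, map_add, coeff_C_mul]
  have hUV : ∀ j, U (j + 1) = X * (C a * U (j + 1) + V j) := fun j => by
    have e : U (j + 1) = (mk fun n => a ^ n) * (X * V j) := by
      simp only [hU, hV, excursionSeries]; ring
    conv_lhs => rw [e, mk_pow_eq_one_add a]
    rw [e]; ring
  have hUV' : ∀ n j, coeff (n + 1) (U (j + 1)) = a * coeff n (U (j + 1)) + coeff n (V j) :=
    fun n j => by conv_lhs => rw [hUV, coeff_succ_X_mul, map_add, coeff_C_mul]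
  have hU0 : ∀ n, coeff n (U 0) = a ^ n := fun n => by simp [hU, excursionSeries]
  induction n with
  | zero =>
    have h0 : ∀ j, coeff 0 (U (j + 1)) = 0 := fun j => by
      rw [hUV, coeff_zero_X_mul]
    have h1 : ∀ j, coeff 0 (V j) = 0 := fun j => coeff_zero_X_mul _
    rw [Finset.sum_range_succ']
    simp only [h0, hU0]
    simp
  | succ n ih =>
    obtain ⟨ih0, ih1⟩ := ih (by omega)
    have e0 : (M ^ (n + 1)) 0 0 = a * (M ^ n) 0 0 + b * (M ^ n) 1 0 := by
      rw [pow_succ', Matrix.mul_apply, Fin.sum_univ_two]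
    have e1 : (M ^ (n + 1)) 1 0 = c * (M ^ n) 0 0 + d * (M ^ n) 1 0 := by
      rw [pow_succ', Matrix.mul_apply, Fin.sum_univ_two]
    rw [e0, e1, ih0, ih1]
    constructor
    -- Truncation at J loses nothing: V I starts in degree 2I + 1, which exceeds n.
    · have hz : coeff n (V I) = 0 := by
        have : V I =
            X ^ (2 * I + 1) * ((mk fun n => a ^ n) ^ (I + 1) * (mk fun n => d ^ n) ^ (I + 1)) := by
          simp only [hV, hU, excursionSeries]; ring
        rw [this, coeff_X_pow_mul', if_neg (by omega)]
      rw [Finset.sum_range_succ (fun j => (b * c) ^ j * coeff n (V j)) I, hz,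
        Finset.sum_range_succ', Finset.sum_range_succ']
      have : ∑ j ∈ Finset.range I, (b * c) ^ (j + 1) * coeff (n + 1) (U (j + 1)) =
          a * ∑ j ∈ Finset.range I, (b * c) ^ (j + 1) * coeff n (U (j + 1)) +
            b * c * ∑ j ∈ Finset.range I, (b * c) ^ j * coeff n (V j) := by
        rw [Finset.mul_sum, Finset.mul_sum, ← Finset.sum_add_distrib]
        refine Finset.sum_congr rfl fun j _ => ?_
        rw [hUV']; ring
      rw [this, hU0, hU0]
      ring
    · have : ∑ j ∈ Finset.range (I + 1), (b * c) ^ j * coeff (n + 1) (V j) =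
          ∑ j ∈ Finset.range (I + 1), (b * c) ^ j * coeff n (U j) +
            d * ∑ j ∈ Finset.range (I + 1), (b * c) ^ j * coeff n (V j) := by
        rw [Finset.mul_sum, ← Finset.sum_add_distrib]
        refine Finset.sum_congr rfl fun j _ => ?_
        rw [hVU]; ring
      rw [this]
      ring

/-- The path-counting polynomial of length `n`, with loop weights `a` and `d` and weight `x` of
an excursion. -/
noncomputable def pathSum (a d x : ℂ) (n : ℕ) : ℂ :=
  ∑ j ∈ Finset.Icc 0 (n / 2), ∑ k ∈ Finset.Icc 1 (n - j),
    (pathBinom j k : ℂ) * ((n - (k + j - 1)).choose j : ℂ) *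
      (x ^ j * d ^ (k - 1) * a ^ (n + 1 - (k + 2 * j)))

theorem matrix_pow_zero_zero (M : Matrix (Fin 2) (Fin 2) ℂ) {n : ℕ} (hn : 0 < n) :
    (M ^ n) 0 0 = pathSum (M 0 0) (M 1 1) (M 0 1 * M 1 0) n := by
  rw [(matrix_pow_eq_sum_coeff M (n / 2 + 1) n (by omega)).1, pathSum,
    Nat.range_succ_eq_Icc_zero]
  refine Finset.sum_congr rfl fun j hj => ?_
  have hj : 2 * j ≤ n := by rw [Finset.mem_Icc] at hj; omega
  rw [coeff_excursionSeries _ _ j n hj, Finset.mul_sum]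
  -- The two ranges differ only by zero terms. For j = 0 the extra p = n is killed by `pathBinom`,
  -- as n > 0; for j ≥ 1 the extra k are killed by the second binomial.
  refine Finset.sum_bij_ne_zero (fun p _ _ => p + 1) ?_ ?_ ?_ ?_
  · intro p hp h0
    rw [Finset.mem_range] at hp
    rw [Finset.mem_Icc]
    refine ⟨by omega, ?_⟩
    by_contra hlt
    obtain rfl : j = 0 := by omega
    exact h0 (by simp [pathBinom, show p ≠ 0 by omega])
  · intro _ _ _ _ _ _ hpp
    omega
  · intro k hk h0
    rw [Finset.mem_Icc] at hk
    have hk' : ¬ n - (k + j - 1) < j := fun hlt => h0 (by simp [Nat.choose_eq_zero_of_lt hlt])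
    refine ⟨k - 1, Finset.mem_range.mpr (by omega), ?_, by omega⟩
    intro h1
    refine h0 ?_
    rw [← h1, show k - 1 + 1 = k by omega, show n - (k - 1 + j) = n - (k + j - 1) by omega,
      show n - 2 * j - (k - 1) = n + 1 - (k + 2 * j) by omega]
    ring
  · intro p hp _
    rw [show n - (p + 1 + j - 1) = n - (p + j) by omega, Nat.add_sub_cancel,
      show n + 1 - (p + 1 + 2 * j) = n - 2 * j - p by omega]
    ring

theorem trace_matrix_pow (M : Matrix (Fin 2) (Fin 2) ℂ) {n : ℕ} (hn : 0 < n) :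
    (M ^ n).trace = pathSum (M 0 0) (M 1 1) (M 0 1 * M 1 0) n +
      pathSum (M 1 1) (M 0 0) (M 0 1 * M 1 0) n := by
  -- Exchanging the two vertices reduces the other diagonal entry to the first.
  have h : (M ^ n) 1 1 =
      (Matrix.reindexAlgEquiv ℂ ℂ (Equiv.swap (0 : Fin 2) 1) M ^ n) 0 0 := by
    rw [← map_pow]
    simp
  rw [Matrix.trace_fin_two, h, matrix_pow_zero_zero _ hn, matrix_pow_zero_zero _ hn]
  simp [mul_comm]

/-! ### Expansion of the path-counting sums -/

/-- The signed Laurent monomial `(-1)^e q^f`. -/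
noncomputable def signedMonomial (q : ℂ) (e f : ℤ) : ℂ := (-1) ^ e * q ^ f

theorem signedMonomial_mul {q : ℂ} (hq : q ≠ 0) (e f e' f' : ℤ) :
    signedMonomial q e f * signedMonomial q e' f' = signedMonomial q (e + e') (f + f') := by
  rw [signedMonomial, signedMonomial, signedMonomial, zpow_add₀ (by norm_num), zpow_add₀ hq]
  ring

theorem signedMonomial_pow (q : ℂ) (e f : ℤ) (k : ℕ) :
    signedMonomial q e f ^ k = signedMonomial q (e * k) (f * k) := by
  rw [signedMonomial, signedMonomial, mul_pow, zpow_mul, zpow_mul, zpow_natCast, zpow_natCast]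

theorem signedMonomial_congr (q : ℂ) {e f e' f' : ℤ} (c : ℤ) (he : e = e' + 2 * c) (hf : f = f') :
    signedMonomial q e f = signedMonomial q e' f' := by
  rw [signedMonomial, signedMonomial, he, hf, zpow_add₀ (by norm_num), zpow_mul]
  norm_num

/-- The exponents of -1 in Ω and G may be half-integers; only their sum is an integer. -/
theorem neg_one_cpow_mul_cpow {u v : ℂ} (e : ℤ) (h : u + v = e) :
    (-1 : ℂ) ^ u * (-1 : ℂ) ^ v = (-1) ^ e := by
  rw [← Complex.cpow_add _ _ (by norm_num), h, Complex.cpow_intCast]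

/-- The product of three binomial expansions. -/
theorem mul_pow_expansion (κ y z s u v y₁ y₂ z₁ z₂ : ℂ) (j p r : ℕ) :
    (κ * s * (u + v) ^ 2) ^ j * (y * (s * y₂ + y₁)) ^ p * (z * (s * z₂ + z₁)) ^ r =
      ∑ k₁ ∈ Finset.range (r + 1), ∑ k₂ ∈ Finset.range (p + 1),
        ∑ k₃ ∈ Finset.range (2 * j + 1),
          (r.choose k₁ : ℂ) * ((2 * j).choose k₃ : ℂ) * (p.choose k₂ : ℂ) * s ^ (j + k₁ + k₂) *
            (κ ^ j * y ^ p * z ^ r * (u ^ k₃ * v ^ (2 * j - k₃)) * (y₂ ^ k₂ * y₁ ^ (p - k₂)) *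
              (z₂ ^ k₁ * z₁ ^ (r - k₁))) := by
  rw [mul_pow, ← pow_mul, mul_pow, mul_pow y, mul_pow z, add_pow u, add_pow _ y₁, add_pow _ z₁,
    Finset.mul_sum _ _ (z ^ r), Finset.mul_sum]
  refine Finset.sum_congr rfl fun k₁ _ => ?_
  rw [Finset.mul_sum _ _ (y ^ p), Finset.mul_sum, Finset.sum_mul]
  refine Finset.sum_congr rfl fun k₂ _ => ?_
  rw [Finset.mul_sum, Finset.sum_mul, Finset.sum_mul]
  refine Finset.sum_congr rfl fun k₃ _ => ?_
  ring

theorem mul_div_mul_mul_eq {P C S T N Q t ε μ : ℂ} (h : P * N = ε) (ht : T⁻¹ = t)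
    (hμ : ε * Q = μ) : P * (C * (S / T) * N * Q) = C * S * (t * μ) := by
  rw [← hμ, ← h, ← ht, div_eq_mul_inv]
  ring

/-- The upper diagonal entry of the matrix of `σ₁^{m₁} σ₂^{-m₂}` on the multiplicity space of
`[2,1,0]`, up to a power of `A`. -/
noncomputable def upperLoopWeight (m₁ m₂ : ℕ) (q : ℂ) : ℂ :=
  (qnum q 2 ^ 2)⁻¹ * signedMonomial q 0 m₁ *
    (qnum q 3 * signedMonomial q m₂ m₂ + signedMonomial q 0 (-m₂))

/-- The lower diagonal entry of the same matrix. -/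
noncomputable def lowerLoopWeight (m₁ m₂ : ℕ) (q : ℂ) : ℂ :=
  (qnum q 2 ^ 2)⁻¹ * signedMonomial q m₁ (-m₁) *
    (qnum q 3 * signedMonomial q 0 (-m₂) + signedMonomial q m₂ m₂)

/-- The product of the off-diagonal entries of the same matrix. -/
noncomputable def excursionWeight (m₁ m₂ : ℕ) (q : ℂ) : ℂ :=
  (qnum q 2 ^ 4)⁻¹ * (signedMonomial q 0 m₁ * signedMonomial q m₁ (-m₁)) * qnum q 3 *
    (signedMonomial q m₂ m₂ + signedMonomial q 1 (-m₂)) ^ 2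

/-- With k = p + 1 and n = p + r + 2j, the term ℓ₁ = 1 comes from walks based at the lower vertex
and ℓ₁ = 2 from walks based at the upper one. -/
theorem neg_one_cpow_mul_Gsum (m₁ m₂ j p r : ℕ) {q : ℂ} (hq : q ≠ 0) :
    (-1 : ℂ) ^ (-(((p + r + 2 * j : ℕ) : ℂ) * ((m₁ : ℂ) - (m₂ : ℂ))) / 2) *
        Gsum m₁ m₂ j (p + 1) (p + r + 2 * j) q =
      excursionWeight m₁ m₂ q ^ j * upperLoopWeight m₁ m₂ q ^ p * lowerLoopWeight m₁ m₂ q ^ r +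
      excursionWeight m₁ m₂ q ^ j * lowerLoopWeight m₁ m₂ q ^ p * upperLoopWeight m₁ m₂ q ^ r := by
  rw [excursionWeight, upperLoopWeight, lowerLoopWeight]
  rw [mul_pow_expansion, mul_pow_expansion, ← Finset.sum_add_distrib, Gsum, Finset.mul_sum,
    show p + r + 2 * j + 2 - (2 * j + (p + 1)) = r + 1 by omega]
  refine Finset.sum_congr rfl fun k₁ hk₁ => ?_
  rw [Finset.mul_sum, ← Finset.sum_add_distrib, Nat.add_sub_cancel, ← Nat.range_succ_eq_Icc_zero]
  refine Finset.sum_congr rfl fun k₂ hk₂ => ?_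
  rw [Finset.mul_sum, ← Finset.sum_add_distrib, ← Nat.range_succ_eq_Icc_zero]
  refine Finset.sum_congr rfl fun k₃ hk₃ => ?_
  obtain ⟨r', rfl⟩ := Nat.exists_eq_add_of_le (Finset.mem_range_succ_iff.mp hk₁)
  obtain ⟨p', rfl⟩ := Nat.exists_eq_add_of_le (Finset.mem_range_succ_iff.mp hk₂)
  obtain ⟨j', hj'⟩ := Nat.exists_eq_add_of_le (Finset.mem_range_succ_iff.mp hk₃)
  have hj'' : (2 * j : ℤ) = k₃ + j' := by exact_mod_cast hj'
  have hI : Finset.Icc 1 2 = ({1, 2} : Finset ℕ) := rfl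
  have hμ : ArithmeticFunction.moebius 2 = -1 :=
    ArithmeticFunction.moebius_apply_prime Nat.prime_two
  rw [hI, Finset.sum_pair (by norm_num), ArithmeticFunction.moebius_apply_one, hμ,
    show (k₂ + p') + (k₁ + r') + 2 * j + 1 - (k₂ + p' + 1 + 2 * j) = k₁ + r' by omega,
    show 2 * j - k₃ = j' by omega, Nat.add_sub_cancel_left, Nat.add_sub_cancel_left]
  -- The prefactor contributes -nα/2. It doubles the -nα/2 in the exponent for μ = 1 and cancels its
  -- negative for μ = -1 in `h2`.
  have h1 := neg_one_cpow_mul_cpow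
    (u := -(((k₂ + p' + (k₁ + r') + 2 * j : ℕ) : ℂ) * ((m₁ : ℂ) - (m₂ : ℂ))) / 2)
    (v := ((1 : ℤ) : ℂ) * ((((m₁ : ℤ) - (m₂ : ℤ) : ℤ) : ℂ) * (((k₂ + p' + 1 : ℕ) : ℂ) - 1 -
      ((k₂ + p' + (k₁ + r') + 2 * j : ℕ) : ℂ) / 2) + (m₂ : ℂ) * ((k₂ : ℂ) - (k₁ : ℂ))) +
        (k₃ : ℂ) * ((m₂ : ℂ) + 1) - (m₁ : ℂ) * (j : ℂ))
    (((m₁ : ℤ) - m₂) * (-(k₁ + r') - 2 * j) + m₂ * (k₂ - k₁) + k₃ * (m₂ + 1) - m₁ * j)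
    (by push_cast; ring)
  have h2 := neg_one_cpow_mul_cpow
    (u := -(((k₂ + p' + (k₁ + r') + 2 * j : ℕ) : ℂ) * ((m₁ : ℂ) - (m₂ : ℂ))) / 2)
    (v := ((-1 : ℤ) : ℂ) * ((((m₁ : ℤ) - (m₂ : ℤ) : ℤ) : ℂ) * (((k₂ + p' + 1 : ℕ) : ℂ) - 1 -
      ((k₂ + p' + (k₁ + r') + 2 * j : ℕ) : ℂ) / 2) + (m₂ : ℂ) * ((k₂ : ℂ) - (k₁ : ℂ))) +
        (k₃ : ℂ) * ((m₂ : ℂ) + 1) - (m₁ : ℂ) * (j : ℂ))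
    (-((m₁ : ℤ) - m₂) * (k₂ + p') - m₂ * (k₂ - k₁) + k₃ * (m₂ + 1) - m₁ * j)
    (by push_cast; ring)
  have ht : (qnum q 2 ^ (2 * ((k₂ + p') + (k₁ + r') + 2 * j)))⁻¹ = ((qnum q 2 ^ 4)⁻¹) ^ j *
      ((qnum q 2 ^ 2)⁻¹) ^ (k₂ + p') * ((qnum q 2 ^ 2)⁻¹) ^ (k₁ + r') := by
    rw [inv_pow, inv_pow, inv_pow, ← mul_inv, ← mul_inv, ← pow_mul, ← pow_mul, ← pow_mul,
      ← pow_add, ← pow_add]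
    congr 2
    ring
  rw [mul_add]
  congr 1
  · refine (mul_div_mul_mul_eq h1 ht
      (μ := (signedMonomial q 0 m₁ * signedMonomial q m₁ (-m₁)) ^ j *
          signedMonomial q 0 m₁ ^ (k₂ + p') * signedMonomial q m₁ (-m₁) ^ (k₁ + r') *
          (signedMonomial q m₂ m₂ ^ k₃ * signedMonomial q 1 (-m₂) ^ j') *
          (signedMonomial q m₂ m₂ ^ k₂ * signedMonomial q 0 (-m₂) ^ p') *
          (signedMonomial q 0 (-m₂) ^ k₁ * signedMonomial q m₂ m₂ ^ r')) ?_).trans ?_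
    · simp only [signedMonomial_mul hq, signedMonomial_pow]
      -- The signs agree because the exponents of -1 differ by twice this integer.
      exact signedMonomial_congr q (-m₁ * (k₁ + r') - 2 * m₁ * j + m₂ * j + k₃ - j)
        (by push_cast; linear_combination hj'')
        (by push_cast; linear_combination (-m₂ : ℤ) * hj'')
    · congr 1
      simp only [mul_pow]
      ring
  · refine (mul_div_mul_mul_eq h2 ht
      (μ := (signedMonomial q 0 m₁ * signedMonomial q m₁ (-m₁)) ^ j *
          signedMonomial q m₁ (-m₁) ^ (k₂ + p') * signedMonomial q 0 m₁ ^ (k₁ + r') *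
          (signedMonomial q m₂ m₂ ^ k₃ * signedMonomial q 1 (-m₂) ^ j') *
          (signedMonomial q 0 (-m₂) ^ k₂ * signedMonomial q m₂ m₂ ^ p') *
          (signedMonomial q m₂ m₂ ^ k₁ * signedMonomial q 0 (-m₂) ^ r')) ?_).trans ?_
    · simp only [signedMonomial_mul hq, signedMonomial_pow]
      exact signedMonomial_congr q (-m₁ * (k₂ + p') - m₁ * j + k₃ - j)
        (by push_cast; linear_combination hj'')
        (by push_cast; linear_combination (-m₂ : ℤ) * hj'')
    · congr 1
      simp only [mul_pow]
      ring

theorem Omega_eq_pathSum_add (m₁ m₂ n : ℕ) {q : ℂ} (hq : q ≠ 0) :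
    Omega m₁ m₂ n q =
      pathSum (upperLoopWeight m₁ m₂ q) (lowerLoopWeight m₁ m₂ q) (excursionWeight m₁ m₂ q) n +
      pathSum (lowerLoopWeight m₁ m₂ q) (upperLoopWeight m₁ m₂ q) (excursionWeight m₁ m₂ q) n := by
  rw [Omega, pathSum, pathSum, ← Finset.sum_add_distrib]
  refine Finset.sum_congr rfl fun j _ => ?_
  rw [← Finset.sum_add_distrib]
  refine Finset.sum_congr rfl fun k hk => ?_
  obtain ⟨hk1, hk2⟩ := Finset.mem_Icc.mp hk
  by_cases hjk : k + 2 * j ≤ n + 1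
  · obtain ⟨p, rfl⟩ := Nat.exists_eq_add_of_le' hk1
    obtain ⟨r, rfl⟩ : ∃ r, n = p + r + 2 * j := ⟨n - p - 2 * j, by omega⟩
    have := neg_one_cpow_mul_Gsum m₁ m₂ j p r hq
    rw [show p + r + 2 * j + 1 - (p + 1 + 2 * j) = r by omega, Nat.add_sub_cancel,
      mul_assoc _ (pathBinom _ _ : ℂ), mul_right_comm, this]
    ring
  -- Too few steps remain for j excursions, so the second binomial vanishes on both sides.
  · simp [Nat.choose_eq_zero_of_lt (show n - (k + j - 1) < j by omega)]

/-! ### The hybrid weaving braid on the multiplicity spaces -/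

theorem B3.map_hybridWeavingBraid {G : Type*} [Group G] (a b : G) (h : a * b * a = b * a * b)
    (m₁ m₂ n : ℕ) (ℓ : ℤ) : B3.lift a b h (hybridWeavingBraid m₁ m₂ n ℓ) =
      (a ^ m₁ * (b ^ m₂)⁻¹) ^ n * ((a * b) ^ 3) ^ ℓ := by
  simp [hybridWeavingBraid, B3.lift_sigma1, B3.lift_sigma2, zpow_mul]

theorem lift_diag_hybridWeavingBraid (x : ℂˣ) (m₁ m₂ n : ℕ) (ℓ : ℤ) :
    ((B3.lift x x rfl (hybridWeavingBraid m₁ m₂ n ℓ) : ℂˣ) : ℂ) =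
      (x : ℂ) ^ ((n : ℤ) * ((m₁ : ℤ) - m₂) + 6 * ℓ) := by
  rw [B3.map_hybridWeavingBraid, ← Units.val_zpow_eq_zpow_val]
  congr 1
  rw [zpow_add, mul_comm (n : ℤ), zpow_mul, zpow_sub, zpow_mul, zpow_natCast, zpow_natCast,
    zpow_natCast]
  congr 2
  rw [← sq, ← pow_mul]
  rfl

/-- The product M has trace -A⁻² and determinant A⁻⁴, so M² + A⁻²M + A⁻⁴ = 0. This quadratic divides
M³ - A⁻⁶. -/
theorem R1block_mul_R2block_cube {q A : ℂ} (h : Generic q A) :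
    (R1block h * R2block h) ^ 3 =
      Units.map (algebraMap ℂ (Matrix (Fin 2) (Fin 2) ℂ)).toMonoidHom
        (Units.mk0 A⁻¹ (inv_ne_zero h.A_ne)) ^ 6 := by
  have hq := h.q_ne
  have hA := h.A_ne
  have h2 := h.qnum_two_ne
  have h3 : sqrtThree q ^ 2 = qnum q 2 ^ 2 - 1 := by rw [sqrtThree_sq, h.qnum_three]
  have ht : q ^ 2 = qnum q 2 * q - 1 := by
    rw [h.qnum_two, add_mul, inv_mul_cancel₀ hq]; ring
  have hM : (R1block h * R2block h).val = (A⁻¹ ^ 2 * (qnum q 2)⁻¹) •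
      !![-q⁻¹, -(q * sqrtThree q); q⁻¹ * sqrtThree q, -q] := by
    rw [Units.val_mul, R1block_val, R2block_val, smul_mul_smul_comm]
    congr 1
    · ring
    · ext i j; fin_cases i <;> fin_cases j <;> simp <;> field_simp
  have e : (R1block h * R2block h).val ^ 2 = -A⁻¹ ^ 2 • (R1block h * R2block h).val -
      A⁻¹ ^ 4 • 1 := by
    rw [hM, sq, smul_mul_smul_comm]
    ext i j; fin_cases i <;> fin_cases j <;> simp <;> field_simp
    · linear_combination -q ^ 2 * h3 + ht
    · linear_combination sqrtThree q * ht
    · linear_combination -sqrtThree q * ht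
    · linear_combination -h3 + ht
  ext1
  have e3 : (R1block h * R2block h).val ^ 3 = A⁻¹ ^ 6 • 1 := by
    rw [pow_succ, e, sub_mul, smul_mul_assoc, ← sq, e, smul_mul_assoc, one_mul]
    module
  rw [Units.val_pow_eq_pow_val, e3, ← map_pow, ← Algebra.algebraMap_eq_smul_one]
  rfl

theorem R1block_pow_val {q A : ℂ} (h : Generic q A) (m : ℕ) :
    ((R1block h ^ m : (Matrix (Fin 2) (Fin 2) ℂ)ˣ) : Matrix (Fin 2) (Fin 2) ℂ) =
      A⁻¹ ^ m • !![signedMonomial q 0 m, 0; 0, signedMonomial q m (-m)] := by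
  have e : (!![q, 0; 0, -q⁻¹] : Matrix (Fin 2) (Fin 2) ℂ) = Matrix.diagonal ![q, -q⁻¹] := by
    ext i j; fin_cases i <;> fin_cases j <;> simp
  rw [Units.val_pow_eq_pow_val, R1block_val, smul_pow, e, Matrix.diagonal_pow]
  congr 1
  ext i j; fin_cases i <;> fin_cases j <;> simp [signedMonomial]
  rw [neg_pow]; simp

theorem R1block_inv_pow_val {q A : ℂ} (h : Generic q A) (m : ℕ) :
    (((R1block h)⁻¹ ^ m : (Matrix (Fin 2) (Fin 2) ℂ)ˣ) : Matrix (Fin 2) (Fin 2) ℂ) =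
      A ^ m • !![signedMonomial q 0 (-m), 0; 0, signedMonomial q m m] := by
  have e : (!![q⁻¹, 0; 0, -q] : Matrix (Fin 2) (Fin 2) ℂ) = Matrix.diagonal ![q⁻¹, -q] := by
    ext i j; fin_cases i <;> fin_cases j <;> simp
  have e' : ((R1block h)⁻¹ : (Matrix (Fin 2) (Fin 2) ℂ)ˣ).val = A • !![q⁻¹, 0; 0, -q] := rfl
  rw [Units.val_pow_eq_pow_val, e', smul_pow, e, Matrix.diagonal_pow]
  congr 1
  ext i j; fin_cases i <;> fin_cases j <;> simp [signedMonomial]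
  rw [neg_pow]

/-- The matrix of `σ₁^{m₁} σ₂^{-m₂}` on the multiplicity space of `[2,1,0]`, up to a power
of `A`. -/
noncomputable def weavingBlock (m₁ m₂ : ℕ) (q : ℂ) : Matrix (Fin 2) (Fin 2) ℂ :=
  (qnum q 2 ^ 2)⁻¹ • !![signedMonomial q 0 m₁, 0; 0, signedMonomial q m₁ (-m₁)] *
    !![1, sqrtThree q; -sqrtThree q, 1] *
    !![signedMonomial q 0 (-m₂), 0; 0, signedMonomial q m₂ m₂] *
    !![1, -sqrtThree q; sqrtThree q, 1]

theorem R1block_pow_mul_R2block_pow_inv {q A : ℂ} (h : Generic q A) (m₁ m₂ : ℕ) :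
    ((R1block h ^ m₁ * (R2block h ^ m₂)⁻¹ : (Matrix (Fin 2) (Fin 2) ℂ)ˣ) :
        Matrix (Fin 2) (Fin 2) ℂ) = A⁻¹ ^ ((m₁ : ℤ) - m₂) • weavingBlock m₁ m₂ q := by
  -- Conjugation by U reduces powers of R₂ to powers of the diagonal matrix R₁.
  have e : (R2block h ^ m₂)⁻¹ = Ublock h * (R1block h)⁻¹ ^ m₂ * (Ublock h)⁻¹ := by
    rw [R2block, conj_pow, inv_pow]
    group
  have hU : (Ublock h).val = (qnum q 2)⁻¹ • !![1, sqrtThree q; -sqrtThree q, 1] := rfl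
  have hU' : (Ublock h)⁻¹.val = (qnum q 2)⁻¹ • !![1, -sqrtThree q; sqrtThree q, 1] := rfl
  rw [e, Units.val_mul, Units.val_mul, Units.val_mul, R1block_pow_val, R1block_inv_pow_val, hU, hU',
    weavingBlock, zpow_sub₀ (inv_ne_zero h.A_ne)]
  simp only [smul_mul_assoc, mul_smul_comm, smul_smul, mul_assoc]
  congr 1
  have := h.A_ne
  simp
  ring

/-- Only the diagonal entries and the product of the off-diagonal ones enter the trace, so √[3]
occurs only squared and the choice of root is immaterial. -/
theorem trace_weavingBlock_pow {q A : ℂ} (h : Generic q A) (m₁ m₂ : ℕ) {n : ℕ} (hn : 0 < n) :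
    (weavingBlock m₁ m₂ q ^ n).trace = Omega m₁ m₂ n q := by
  have h3 := sqrtThree_sq q
  have e00 : weavingBlock m₁ m₂ q 0 0 = upperLoopWeight m₁ m₂ q := by
    simp [weavingBlock, upperLoopWeight]
    linear_combination ((qnum q 2 ^ 2)⁻¹ * signedMonomial q 0 m₁ * signedMonomial q m₂ m₂) * h3
  have e11 : weavingBlock m₁ m₂ q 1 1 = lowerLoopWeight m₁ m₂ q := by
    simp [weavingBlock, lowerLoopWeight]
    linear_combination
      ((qnum q 2 ^ 2)⁻¹ * signedMonomial q m₁ (-m₁) * signedMonomial q 0 (-m₂)) * h3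
  have eneg : signedMonomial q 1 (-m₂) = -signedMonomial q 0 (-m₂) := by simp [signedMonomial]
  have e01 : weavingBlock m₁ m₂ q 0 1 * weavingBlock m₁ m₂ q 1 0 = excursionWeight m₁ m₂ q := by
    rw [excursionWeight, eneg, ← h3]
    simp [weavingBlock]
    ring
  rw [trace_matrix_pow _ hn, Omega_eq_pathSum_add _ _ _ h.q_ne, e00, e11, e01]

theorem trace_rho21_hybridWeavingBraid {q A : ℂ} (h : Generic q A) (m₁ m₂ : ℕ) {n : ℕ}
    (hn : 0 < n) (ℓ : ℤ) :
    (rho21 h (hybridWeavingBraid m₁ m₂ n ℓ)).val.trace =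
      (1 / A) ^ ((n : ℤ) * ((m₁ : ℤ) - m₂) + 6 * ℓ) * Omega m₁ m₂ n q := by
  rw [rho21, B3.map_hybridWeavingBraid, R1block_mul_R2block_cube, Units.val_mul,
    Units.val_pow_eq_pow_val, R1block_pow_mul_R2block_pow_inv, ← zpow_natCast _ 6, ← zpow_mul,
    ← map_zpow, smul_pow, ← trace_weavingBlock_pow h m₁ m₂ hn]
  have : ∀ x : ℂˣ, (Units.map (algebraMap ℂ (Matrix (Fin 2) (Fin 2) ℂ)).toMonoidHom x).val =
      (x : ℂ) • 1 := fun x => Algebra.algebraMap_eq_smul_one _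
  rw [this, Units.val_zpow_eq_zpow_val, Units.val_mk0, smul_mul_smul_comm, mul_one,
    Matrix.trace_smul, smul_eq_mul, one_div, zpow_add₀ (inv_ne_zero h.A_ne), mul_comm (n : ℤ),
    zpow_mul _ _ (n : ℤ), zpow_natCast]
  rfl

/-! ### The closed formula for the invariants -/

theorem homflyPT_hybridWeavingBraid {q A : ℂ} (h : Generic q A) (m₁ m₂ : ℕ) {n : ℕ}
    (hn : 0 < n) (ℓ : ℤ) :
    homflyPT h (hybridWeavingBraid m₁ m₂ n ℓ) =
      1 / S1 A q *
        ((q / A) ^ ((n : ℤ) * ((m₁ : ℤ) - m₂) + 6 * ℓ) * S3 A q +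
          (-(q * A)) ^ (-((n : ℤ) * ((m₁ : ℤ) - m₂)) - 6 * ℓ) * S111 A q +
          (1 / A) ^ ((n : ℤ) * ((m₁ : ℤ) - m₂) + 6 * ℓ) * S21 A q * Omega m₁ m₂ n q) := by
  have e : -1 / (q * A) = (-(q * A))⁻¹ := by rw [inv_neg, neg_div, one_div]
  rw [homflyPT, rho3, rho111, lift_diag_hybridWeavingBraid, lift_diag_hybridWeavingBraid,
    trace_rho21_hybridWeavingBraid h m₁ m₂ hn, Units.val_mk0, Units.val_mk0, e, inv_zpow',
    neg_add']
  ring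

theorem proposition2 (m₁ m₂ n : ℕ) (hm₁ : 0 < m₁) (hm₂ : 0 < m₂) (hn : 0 < n) (ℓ : ℤ)
    (α : ℤ) (hα : α = (m₁ : ℤ) - (m₂ : ℤ)) (q A : ℂ) (h : Generic q A) :
    homflyPT h (hybridWeavingBraid m₁ m₂ n ℓ) =
        1 / S1 A q *
          ((q / A) ^ ((n : ℤ) * α + 6 * ℓ) * S3 A q +
            (-(q * A)) ^ (-((n : ℤ) * α) - 6 * ℓ) * S111 A q +
            (1 / A) ^ ((n : ℤ) * α + 6 * ℓ) * S21 A q * Omega m₁ m₂ n q) ∧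
      ∀ N : ℕ, A = q ^ N →
        quantumTraceInvariant N h.q_ne (hybridWeavingBraid m₁ m₂ n ℓ) =
          1 / S1 A q *
            ((q / A) ^ ((n : ℤ) * α + 6 * ℓ) * S3 A q +
              (-(q * A)) ^ (-((n : ℤ) * α) - 6 * ℓ) * S111 A q +
              (1 / A) ^ ((n : ℤ) * α + 6 * ℓ) * S21 A q * Omega m₁ m₂ n q) := by
  subst hα
  refine ⟨homflyPT_hybridWeavingBraid h m₁ m₂ hn ℓ, fun N hN => ?_⟩
  rw [quantumTraceInvariant_eq_homflyPT N h hN]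
  exact homflyPT_hybridWeavingBraid h m₁ m₂ hn ℓ
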